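/- Let $X, Y \subset \mathbb{R}^n$ be compact, with $Y$ of non-empty interior, and let $c : X \times Y \to \mathbb{R}$ be a function (the cost). Assume that $c$ is twice differentiable up to the boundary in the following sense: for all $(x,y) \in X\times Y$ the function $c(\cdot,y)$ is differentiable at $x$ relative to $X$ with gradient $D_xc(x,y)\in\mathbb{R}^n$; the function $c(x,\cdot)$ is differentiable at $y$ relative to $Y$ with gradient $D_yc(x,y)\in\mathbb{R}^n$; the map $D_xc(x,\cdot)$ is differentiable at $y$ relative to $Y$ with derivative $D^2_{xy}c(x,y)$; the map $D_yc(\cdot,y)$ is differentiable at $x$ relative to $X$ with derivative $D^2_{yx}c(x,y)$; and $(D^2_{xy}c)^{T} = D^2_{yx}c$ on $X\times Y$. (If $X$ has empty interior, such derivatives need not be unique; then any fixed choice satisfying all the assumptions is allowed.) Suppose that * (Twisted) $-D_xc(x,\cdot): Y \to \mathbb{R}^n$ is injective for every $x\in X$; * (Twisted*) $-D_yc(\cdot,y): X \to \mathbb{R}^n$ is injective for every $y\in Y$; * (Non-degenerate) $D^2_{xy}c(x,y)$ is invertible for every $(x,y)\in X\times Y$; * (Lip hessian) $D^2_{xy}c$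 is Lipschitz on $X\times Y$; * (cDomConv) $Y^*_x := -D_xc(x,Y)$ is convex for every $x\in X$; * (cDomConv*) $X^*_y := -D_yc(X,y)$ is convex for every $y\in Y$. For $x\in X$ let $\exp^c_x : Y^*_x\to Y$ be the inverse of $-D_xc(x,\cdot)$. For $x_0\in X$, $v_0,v_1\in Y^*_{x_0}$ and $t\in[0,1]$ put $v_t=(1-t)v_0+tv_1$ and $$f_t(x) = -c\bigl(x,\exp^c_{x_0}(v_t)\bigr)+c\bigl(x_0,\exp^c_{x_0}(v_t)\bigr),\qquad x\in X.$$ If $c$ satisfies Loeper's condition, i.e. $$f_t(x)\le\max\{f_1(x),f_0(x)\}\quad\text{for all } x,x_0\in X,\ v_0,v_1\in Y^*_{x_0},\ t\in[0,1],$$ then $c$ is quantitatively quasi-convex (QQconv): there is a constant $M\ge 1$ such that $$f_t(x)-f_0(x)\le M\,t\,\bigl(f_1(x)-f_0(x)\bigr)_+\quad\text{for all } x,x_0\in X,\ v_0,v_1\in Y^*_{x_0},\ t\in[0,1].$$ -/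

import Mathlib

open Set
open scoped NNReal

/-- `ℝⁿ` with its Euclidean structure; it is identified with its dual, so that the covectors
`D_x c` and `D_y c` are represented by gradients. -/
abbrev Rn (n : ℕ) : Type := EuclideanSpace ℝ (Fin n)

/-- `c` has, on `X × Y`, the partial gradients `D_x c = Dx`, `D_y c = Dy` and the mixed Hessians
`D²_{xy} c = Dxy` (the `y`-derivative of `D_x c`) and `D²_{yx} c = Dyx` (the `x`-derivative of
`D_y c`). All derivatives are taken relative to the sets `X` and `Y`, i.e. up to the boundary;
only the values of `c` on `X × Y` matter. -/
structure HasMixedHessians {n : ℕ} (X Y : Set (Rn n)) (c : Rn n → Rn n → ℝ)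
    (Dx Dy : Rn n → Rn n → Rn n) (Dxy Dyx : Rn n → Rn n → Rn n →L[ℝ] Rn n) : Prop where
  grad_x : ∀ x ∈ X, ∀ y ∈ Y, HasGradientWithinAt (fun x' => c x' y) (Dx x y) X x
  grad_y : ∀ x ∈ X, ∀ y ∈ Y, HasGradientWithinAt (fun y' => c x y') (Dy x y) Y y
  hess_xy : ∀ x ∈ X, ∀ y ∈ Y, HasFDerivWithinAt (fun y' => Dx x y') (Dxy x y) Y y
  hess_yx : ∀ x ∈ X, ∀ y ∈ Y, HasFDerivWithinAt (fun x' => Dy x' y) (Dyx x y) X x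

/-- `Y*_x = -D_x c(x, Y)`. -/
def YStar {n : ℕ} (Y : Set (Rn n)) (Dx : Rn n → Rn n → Rn n) (x : Rn n) : Set (Rn n) :=
  (fun y => -Dx x y) '' Y

/-- `X*_y = -D_y c(X, y)`. -/
def XStar {n : ℕ} (X : Set (Rn n)) (Dy : Rn n → Rn n → Rn n) (y : Rn n) : Set (Rn n) :=
  (fun x => -Dy x y) '' X

/-- The `c`-exponential map `exp_x^c : Y*_x → Y`, the inverse of `-D_x c(x, ·)` on `Y`
(with an irrelevant value outside `Y*_x`). -/
noncomputable def cExp {n : ℕ} (Y : Set (Rn n)) (Dx : Rn n → Rn n → Rn n) (x p : Rn n) : Rn n :=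
  Function.invFunOn (fun y => -Dx x y) Y p

theorem cExp_mem {n : ℕ} {Y : Set (Rn n)} {Dx : Rn n → Rn n → Rn n} {x p : Rn n}
    (hp : p ∈ YStar Y Dx x) : cExp Y Dx x p ∈ Y :=
  Function.invFunOn_mem hp

theorem neg_Dx_cExp {n : ℕ} {Y : Set (Rn n)} {Dx : Rn n → Rn n → Rn n} {x p : Rn n}
    (hp : p ∈ YStar Y Dx x) : -Dx x (cExp Y Dx x p) = p :=
  Function.invFunOn_eq (f := fun y => -Dx x y) hp

/-- The function `f_t(x) = -c(x, exp_{x₀}^c(v_t)) + c(x₀, exp_{x₀}^c(v_t))`, where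
`v_t = (1 - t) v₀ + t v₁`. -/
noncomputable def fSeg {n : ℕ} (Y : Set (Rn n)) (c : Rn n → Rn n → ℝ) (Dx : Rn n → Rn n → Rn n)
    (x₀ v₀ v₁ : Rn n) (t : ℝ) (x : Rn n) : ℝ :=
  -c x (cExp Y Dx x₀ ((1 - t) • v₀ + t • v₁)) + c x₀ (cExp Y Dx x₀ ((1 - t) • v₀ + t • v₁))

/-- Loeper's condition: `f_t(x) ≤ max {f_1(x), f_0(x)}`. -/
def LoeperCondition {n : ℕ} (X Y : Set (Rn n)) (c : Rn n → Rn n → ℝ)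
    (Dx : Rn n → Rn n → Rn n) : Prop :=
  ∀ x ∈ X, ∀ x₀ ∈ X, ∀ v₀ ∈ YStar Y Dx x₀, ∀ v₁ ∈ YStar Y Dx x₀, ∀ t ∈ Icc (0 : ℝ) 1,
    fSeg Y c Dx x₀ v₀ v₁ t x ≤ max (fSeg Y c Dx x₀ v₀ v₁ 1 x) (fSeg Y c Dx x₀ v₀ v₁ 0 x)

/-- Quantitative quasi-convexity: `f_t(x) - f_0(x) ≤ M t (f_1(x) - f_0(x))₊`
with a uniform constant `M ≥ 1`. -/
def QQconv {n : ℕ} (X Y : Set (Rn n)) (c : Rn n → Rn n → ℝ)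
    (Dx : Rn n → Rn n → Rn n) : Prop :=
  ∃ M : ℝ, 1 ≤ M ∧
    ∀ x ∈ X, ∀ x₀ ∈ X, ∀ v₀ ∈ YStar Y Dx x₀, ∀ v₁ ∈ YStar Y Dx x₀, ∀ t ∈ Icc (0 : ℝ) 1,
      fSeg Y c Dx x₀ v₀ v₁ t x - fSeg Y c Dx x₀ v₀ v₁ 0 x ≤
        M * t * max (fSeg Y c Dx x₀ v₀ v₁ 1 x - fSeg Y c Dx x₀ v₀ v₁ 0 x) 0

/-! Fix x and x₀. On the convex body K = Y*_{x₀}, the function F(v) = f(x) with contact point exp v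
is quasiconvex by Loeper's condition, and QQconv bounds its early growth along a segment by its
total growth. Its gradient is N(v) = (D²_{xy}c)⁻ᵀ(D_y c(x,y) - D_y c(x₀,y)) at y = exp v. Convexity
of X*_y yields |N v - N w| ≤ L |v - w| |N v|, with L independent of x, x₀ (`norm_gradSeg_sub_le`).

Quasiconvexity alone only keeps a positive slope from turning negative. To make this quantitative,
tilt the endpoint w of a short step against N v, by nearly as much as positivity of the slope at v
allows. The slope towards the tilted point is still nonnegative there, and tilting back gains almost
the original slope, up to the Lipschitz error (`inner_gradient_ge_of_pos`). Grönwall then bounds a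
positive slope by exp(10LD) times any later one, D being a diameter bound, and the mean value
theorem turns slopes into increments.

Tilting needs room around the segment, so interior endpoints come first; continuity gives the rest.
-/

/-! ### Quasiconvex functions with relatively Lipschitz gradient -/

section QuasiconvexGradient

open Topology

variable {E : Type*} [NormedAddCommGroup E] [InnerProductSpace ℝ E]
  {K : Set E} {F : E → ℝ} {N : E → E}

/-- The sublevel set at height F v is convex and contains the segment, so v maximizes F there. -/
theorem QuasiconvexOn.inner_gradient_nonpos (hQ : QuasiconvexOn ℝ K F)
    (hF : ∀ v ∈ K, HasFDerivWithinAt F (innerSL ℝ (N v)) K v) {v w : E} (hv : v ∈ K) (hw : w ∈ K)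
    (h : F w ≤ F v) : inner ℝ (N v) (w - v) ≤ 0 := by
  have hseg : segment ℝ v w ⊆ {z ∈ K | F z ≤ F v} :=
    (hQ (F v)).segment_subset ⟨hv, le_rfl⟩ ⟨hw, h⟩
  have hmax : IsLocalMaxOn F (segment ℝ v w) v :=
    Filter.mem_of_superset self_mem_nhdsWithin fun z hz => (hseg hz).2
  exact hmax.hasFDerivWithinAt_nonpos ((hF v hv).mono fun z hz => (hseg hz).1)
    (sub_mem_posTangentConeAt_of_segment_subset Subset.rfl)

theorem QuasiconvexOn.inner_gradient_nonneg_of_pos (hQ : QuasiconvexOn ℝ K F)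
    (hF : ∀ v ∈ K, HasFDerivWithinAt F (innerSL ℝ (N v)) K v) {v w : E} (hv : v ∈ K) (hw : w ∈ K)
    (h : 0 < inner ℝ (N v) (w - v)) : 0 ≤ inner ℝ (N w) (w - v) := by
  have hlt : F v < F w := by
    by_contra! hle
    exact h.not_ge (hQ.inner_gradient_nonpos hF hv hw hle)
  have := hQ.inner_gradient_nonpos hF hw hv hlt.le
  rw [← neg_sub w v, inner_neg_right] at this
  linarith

/-- Along a short segment, a positive directional derivative of a quasiconvex function whose
gradient is relatively Lipschitz decreases at most by a factor close to one. -/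
theorem QuasiconvexOn.inner_gradient_ge_of_pos (hQ : QuasiconvexOn ℝ K F)
    (hF : ∀ v ∈ K, HasFDerivWithinAt F (innerSL ℝ (N v)) K v) {L : ℝ} (hL : 0 ≤ L)
    (hN : ∀ v ∈ K, ∀ w ∈ K, ‖N v - N w‖ ≤ L * ‖v - w‖ * ‖N v‖) {v w : E} (hv : v ∈ K)
    (hball : Metric.closedBall w ‖w - v‖ ⊆ K) (hsmall : L * ‖w - v‖ ≤ 1)
    (hpos : 0 < inner ℝ (N v) (w - v)) :
    (1 - 5 * (L * ‖w - v‖)) * inner ℝ (N v) (w - v) ≤ inner ℝ (N w) (w - v) := by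
  have hw : w ∈ K := hball (Metric.mem_closedBall_self (norm_nonneg _))
  set a : ℝ := inner ℝ (N v) (w - v) with ha
  set h : ℝ := ‖w - v‖ with hh
  have hh0 : 0 ≤ h := norm_nonneg _
  have hNv : 0 < ‖N v‖ := by
    rw [norm_pos_iff]
    intro h0
    simp [ha, h0] at hpos
  have hah : a ≤ ‖N v‖ * h := real_inner_le_norm _ _
  have key : ∀ θ ∈ Ioo (0 : ℝ) 1, θ * ((1 - 5 * (L * h)) * a) ≤ inner ℝ (N w) (w - v) := by
    intro θ hθ
    -- Moving by `-s • N v` lowers the slope at v from a to (1 - θ) a; θ < 1 keeps it positive.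
    set s : ℝ := θ * a / ‖N v‖ ^ 2 with hs
    have hs0 : 0 ≤ s := by have := hθ.1; positivity
    have hsN : s * ‖N v‖ ^ 2 = θ * a := by rw [hs]; field_simp
    have hsn : s * ‖N v‖ = θ * a / ‖N v‖ := by rw [hs]; field_simp
    have hsh : s * ‖N v‖ ≤ h := by
      rw [hsn, div_le_iff₀ hNv]
      nlinarith [hθ.2]
    set w' : E := w - s • N v with hw'
    have hww' : w - w' = s • N v := by simp [hw']
    have hnorm : ‖w - w'‖ = s * ‖N v‖ := by
      rw [hww', norm_smul, Real.norm_of_nonneg hs0]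
    have hw'K : w' ∈ K := by
      apply hball
      rw [Metric.mem_closedBall, dist_comm, dist_eq_norm, hnorm]
      exact hsh
    have hsplit : w' - v = (w - v) - s • N v := by rw [hw']; abel
    have h1 : 0 ≤ inner ℝ (N w') (w' - v) := by
      apply hQ.inner_gradient_nonneg_of_pos hF hv hw'K
      rw [hsplit, inner_sub_right, inner_smul_right, real_inner_self_eq_norm_sq, hsN, ← ha]
      nlinarith [hθ.2]
    have h2 : ‖w' - v‖ ≤ 2 * h := by
      calc ‖w' - v‖ ≤ ‖w - v‖ + ‖s • N v‖ := by rw [hsplit]; exact norm_sub_le _ _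
        _ ≤ 2 * h := by rw [← hww', hnorm]; linarith
    have hNvw := hN v hv w hw
    rw [norm_sub_rev v w, ← hh] at hNvw
    have h3 : (1 - L * h) * ‖N v‖ ^ 2 ≤ inner ℝ (N w) (N v) := by
      have e : inner ℝ (N w) (N v) = ‖N v‖ ^ 2 - inner ℝ (N v - N w) (N v) := by
        rw [inner_sub_left, real_inner_self_eq_norm_sq]; ring
      have := (real_inner_le_norm (N v - N w) (N v)).trans
        (mul_le_mul_of_nonneg_right hNvw hNv.le)
      rw [e]; linarith
    have h4 : ‖N w‖ ≤ 2 * ‖N v‖ := by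
      have := norm_le_norm_add_norm_sub (N v) (N w)
      nlinarith
    have h5 : ‖N w - N w'‖ ≤ L * (2 * (θ * a)) := by
      calc ‖N w - N w'‖ ≤ L * ‖w - w'‖ * ‖N w‖ := hN w hw w' hw'K
        _ ≤ L * ‖w - w'‖ * (2 * ‖N v‖) := by gcongr
        _ = L * (2 * (s * ‖N v‖ ^ 2)) := by rw [hnorm]; ring
        _ = _ := by rw [hsN]
    have h6 : -(L * (2 * (θ * a)) * (2 * h)) ≤ inner ℝ (N w - N w') (w' - v) := by
      have h7 := neg_le_of_abs_le (abs_real_inner_le_norm (N w - N w') (w' - v))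
      have h8 : ‖N w - N w'‖ * ‖w' - v‖ ≤ L * (2 * (θ * a)) * (2 * h) := by
        gcongr
        have := hθ.1
        positivity
      linarith
    -- The first term is at least (1 - Lh) θ a, the second at least -4Lh θ a by `h6`, the third
    -- nonnegative by `h1`; hence the factor 5.
    have h9 : inner ℝ (N w) (w - v) = s * inner ℝ (N w) (N v) + inner ℝ (N w - N w') (w' - v)
        + inner ℝ (N w') (w' - v) := by
      rw [inner_sub_left, hsplit, inner_sub_right (N w) (w - v), inner_smul_right]; ring
    rw [h9]
    have h10 : s * ((1 - L * h) * ‖N v‖ ^ 2) ≤ s * inner ℝ (N w) (N v) := by gcongr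
    have h11 : s * ((1 - L * h) * ‖N v‖ ^ 2) = (1 - L * h) * (θ * a) := by rw [← hsN]; ring
    nlinarith
  have hlim : Filter.Tendsto (fun θ : ℝ => θ * ((1 - 5 * (L * h)) * a)) (𝓝[<] 1)
      (𝓝 (1 * ((1 - 5 * (L * h)) * a))) :=
    (Filter.tendsto_id.mul_const _).mono_left nhdsWithin_le_nhds
  rw [one_mul] at hlim
  exact le_of_tendsto hlim (Filter.mem_of_superset
    (Ioo_mem_nhdsLT one_pos) fun θ hθ => key θ hθ)

/-- A discrete Grönwall inequality. -/
theorem le_exp_mul_of_local_ge {g : ℝ → ℝ} {C η : ℝ} (hC : 0 ≤ C) (hη : 0 < η)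
    (hg : ∀ t ∈ Icc (0 : ℝ) 1, ∀ s ∈ Icc (0 : ℝ) 1, t ≤ s → s - t ≤ η → 0 < g t →
      (1 - C * (s - t)) * g t ≤ g s) {t s : ℝ} (ht : 0 ≤ t) (hts : t ≤ s) (hs : s ≤ 1)
    (hpos : 0 < g t) : g t ≤ Real.exp (2 * C) * g s := by
  obtain ⟨ε, hε, hεη, hεC⟩ : ∃ ε > 0, ε ≤ η ∧ C * ε ≤ 1 / 2 := by
    refine ⟨min η (1 / (2 * (C + 1))), by positivity, min_le_left _ _, ?_⟩
    calc C * min η (1 / (2 * (C + 1))) ≤ C * (1 / (2 * (C + 1))) := by gcongr; exact min_le_right _ _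
      _ ≤ 1 / 2 := by
        rw [mul_one_div, div_le_div_iff₀ (by positivity) (by positivity)]; linarith
  have step : ∀ n : ℕ, ∀ s, t ≤ s → s ≤ 1 → s - t ≤ n * ε →
      g t ≤ Real.exp (2 * C * (s - t)) * g s := by
    intro n
    induction n with
    | zero =>
      intro s hts _ hsn
      have : s = t := by simp at hsn; linarith
      simp [this]
    | succ n ih =>
      intro s hts hs1 hsn
      push_cast at hsn
      -- Step back from s by ε, but not past t.
      have hm1 : t ≤ max t (s - ε) := le_max_left _ _
      have hm2 : max t (s - ε) ≤ s := max_le hts (by linarith)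
      have hm3 : s - max t (s - ε) ≤ ε := by linarith [le_max_right t (s - ε)]
      have hm4 : max t (s - ε) - t ≤ n * ε := by
        rw [sub_le_iff_le_add]
        exact max_le (by nlinarith [(Nat.cast_nonneg n : (0 : ℝ) ≤ n)]) (by linarith)
      generalize max t (s - ε) = m at hm1 hm2 hm3 hm4
      have hgm := ih m hm1 (hm2.trans hs1) hm4
      have hgm0 : 0 < g m := by
        by_contra! hle
        have := mul_nonpos_of_nonneg_of_nonpos (Real.exp_pos (2 * C * (m - t))).le hle
        linarith
      have hloc := hg m ⟨ht.trans hm1, hm2.trans hs1⟩ s ⟨ht.trans hts, hs1⟩ hm2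
        (hm3.trans hεη) hgm0
      set u := C * (s - m) with hu
      have hu0 : 0 ≤ u := mul_nonneg hC (by linarith)
      have hu1 : u ≤ 1 / 2 := (mul_le_mul_of_nonneg_left hm3 hC).trans hεC
      -- (1 + 2u)(1 - u) = 1 + u(1 - 2u) ≥ 1 for 0 ≤ u ≤ 1/2.
      have hexp : 1 ≤ Real.exp (2 * u) * (1 - u) := by
        nlinarith [Real.add_one_le_exp (2 * u)]
      have h1 : g m ≤ Real.exp (2 * u) * g s := by
        calc g m ≤ (Real.exp (2 * u) * (1 - u)) * g m := le_mul_of_one_le_left hgm0.le hexp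
          _ = Real.exp (2 * u) * ((1 - u) * g m) := by ring
          _ ≤ _ := by gcongr
      calc g t ≤ Real.exp (2 * C * (m - t)) * g m := hgm
        _ ≤ Real.exp (2 * C * (m - t)) * (Real.exp (2 * u) * g s) := by gcongr
        _ = _ := by rw [← mul_assoc, ← Real.exp_add, hu]; congr 2; ring
  obtain ⟨n, hn⟩ := exists_nat_ge (1 / ε)
  have hgs := step n s hts hs (by rw [div_le_iff₀ hε] at hn; linarith)
  have hgs0 : 0 < g s := by
    by_contra! hle
    have := mul_nonpos_of_nonneg_of_nonpos (Real.exp_pos (2 * C * (s - t))).le hle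
    linarith
  have hle : 2 * C * (s - t) ≤ 2 * C := mul_le_of_le_one_right (by positivity) (by linarith)
  exact hgs.trans (mul_le_mul_of_nonneg_right (Real.exp_le_exp.2 hle) hgs0.le)

/-- For t ≥ 1/2 quasiconvexity suffices, since 2t ≥ 1. For t < 1/2 the mean slope on [0, t] is
compared with that on [t, 1], an interval of length at least 1/2. The distance to the boundary of K
limits only the Grönwall step, so it does not enter the constant. -/
theorem QuasiconvexOn.sub_le_mul_of_mem_interior (hQ : QuasiconvexOn ℝ K F)
    (hF : ∀ v ∈ K, HasFDerivWithinAt F (innerSL ℝ (N v)) K v) {L D : ℝ} (hL : 0 ≤ L)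
    (hN : ∀ v ∈ K, ∀ w ∈ K, ‖N v - N w‖ ≤ L * ‖v - w‖ * ‖N v‖)
    (hD : ∀ v ∈ K, ∀ w ∈ K, ‖v - w‖ ≤ D) {v w : E} (hv : v ∈ interior K) (hw : w ∈ interior K)
    {t : ℝ} (ht : t ∈ Icc (0 : ℝ) 1) :
    F ((1 - t) • v + t • w) - F v ≤
      2 * Real.exp (10 * (L * D)) * t * max (F w - F v) 0 := by
  have hvK := interior_subset hv
  have hwK := interior_subset hw
  have hD0 : 0 ≤ D := (norm_nonneg _).trans (hD v hvK w hwK)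
  have hexp1 : 1 ≤ Real.exp (10 * (L * D)) := Real.one_le_exp (by positivity)
  have hconv := (quasiconvexOn_iff_le_max.1 hQ).1
  have hmax := (quasiconvexOn_iff_le_max.1 hQ).2
  have hrhs : 0 ≤ 2 * Real.exp (10 * (L * D)) * t * max (F w - F v) 0 := by
    have := ht.1
    positivity
  set γ : ℝ → E := fun t => (1 - t) • v + t • w with hγ
  have hγ0 : γ 0 = v := by simp [hγ]
  have hγ1 : γ 1 = w := by simp [hγ]
  have hγsub : ∀ a b, γ b - γ a = (b - a) • (w - v) := by intro a b; simp only [hγ]; module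
  have hγint : ∀ t ∈ Icc (0 : ℝ) 1, γ t ∈ interior K := fun t ht =>
    hconv.interior hv hw (by linarith [ht.2]) ht.1 (by ring)
  rcases le_or_gt (F (γ t)) (F v) with hle | hlt
  · exact (sub_nonpos.2 hle).trans hrhs
  have hFt : F (γ t) ≤ max (F v) (F w) := hmax hvK hwK (by linarith [ht.2]) ht.1 (by ring)
  have hFw : F (γ t) ≤ F w := (le_max_iff.1 hFt).resolve_left hlt.not_ge
  rw [max_eq_left (by linarith)]
  rcases le_or_gt (1 / 2) t with ht2 | ht2
  · have h1 : 1 * (F w - F v) ≤ 2 * Real.exp (10 * (L * D)) * t * (F w - F v) := by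
      gcongr
      · linarith
      · nlinarith
    linarith
  have ht0 : 0 < t := by
    rcases ht.1.eq_or_lt with h | h
    · rw [← h, hγ0] at hlt; exact absurd hlt (lt_irrefl _)
    · exact h
  set g : ℝ → ℝ := fun t => inner ℝ (N (γ t)) (w - v) with hg
  have hderiv : ∀ t ∈ Icc (0 : ℝ) 1, HasDerivAt (fun t => F (γ t)) (g t) t := by
    intro t ht
    have h1 : HasFDerivAt F (innerSL ℝ (N (γ t))) (γ t) :=
      (hF _ (interior_subset (hγint t ht))).hasFDerivAt (mem_interior_iff_mem_nhds.1 (hγint t ht))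
    have h2 : HasDerivAt γ (w - v) t := by
      have e : γ = fun t => v + t • (w - v) := by funext t; simp only [hγ]; module
      rw [e]
      simpa using ((hasDerivAt_id t).smul_const (w - v)).const_add v
    exact h1.comp_hasDerivAt t h2
  have hγcont : Continuous γ := by fun_prop
  -- A uniform margin δ around the segment leaves room for the tilted endpoints.
  obtain ⟨δ, hδ, hthick⟩ := (isCompact_Icc.image hγcont).exists_cthickening_subset_open
    (isOpen_interior (s := K)) (image_subset_iff.2 hγint)
  have hwv : ‖w - v‖ ≤ D := hD w hwK v hvK
  have hgron : ∀ t ∈ Icc (0 : ℝ) 1, ∀ s ∈ Icc (0 : ℝ) 1, t ≤ s →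
      s - t ≤ min (δ / (D + 1)) (1 / (L * D + 1)) → 0 < g t →
      (1 - 5 * (L * D) * (s - t)) * g t ≤ g s := by
    intro t ht s hs hts hst hpos
    rcases hts.eq_or_lt with rfl | hlt
    · simp
    have hst0 : 0 < s - t := sub_pos.2 hlt
    have hnorm : ‖γ s - γ t‖ = (s - t) * ‖w - v‖ := by
      rw [hγsub, norm_smul, Real.norm_of_nonneg hst0.le]
    have hle : ‖γ s - γ t‖ ≤ (s - t) * D := by rw [hnorm]; gcongr
    have hst1 : (s - t) * (D + 1) ≤ δ :=
      (le_div_iff₀ (by positivity)).1 (hst.trans (min_le_left _ _))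
    have hst2 : (s - t) * (L * D + 1) ≤ 1 :=
      (le_div_iff₀ (by positivity)).1 (hst.trans (min_le_right _ _))
    have hball : Metric.closedBall (γ s) ‖γ s - γ t‖ ⊆ K := by
      refine (Metric.closedBall_subset_closedBall ?_).trans
        ((Metric.closedBall_subset_cthickening (mem_image_of_mem γ hs) δ).trans
          (hthick.trans interior_subset))
      linarith
    have hLle : L * ‖γ s - γ t‖ ≤ L * D * (s - t) := by
      calc L * ‖γ s - γ t‖ ≤ L * ((s - t) * D) := by gcongr
        _ = _ := by ring
    have hpos' : 0 < inner ℝ (N (γ t)) (γ s - γ t) := by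
      rw [hγsub, inner_smul_right]; positivity
    have h := hQ.inner_gradient_ge_of_pos hF hL hN (interior_subset (hγint t ht)) hball
      (by linarith) hpos'
    have hin : ∀ z, inner ℝ z (γ s - γ t) = (s - t) * inner ℝ z (w - v) := fun z => by
      rw [hγsub, inner_smul_right]
    have h' : (1 - 5 * (L * D * (s - t))) * inner ℝ (N (γ t)) (γ s - γ t) ≤
        inner ℝ (N (γ s)) (γ s - γ t) :=
      le_trans (by gcongr) h
    rw [hin, hin] at h'
    have h'' : (s - t) * ((1 - 5 * (L * D) * (s - t)) * g t) ≤ (s - t) * g s := by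
      calc _ = (1 - 5 * (L * D * (s - t))) * ((s - t) * g t) := by ring
        _ ≤ _ := h'
    exact le_of_mul_le_mul_left h'' hst0
  obtain ⟨τ, hτ, hτe⟩ := exists_hasDerivAt_eq_slope (fun t => F (γ t)) g ht0
    (fun r hr => (hderiv r ⟨hr.1, hr.2.trans ht.2⟩).continuousAt.continuousWithinAt)
    (fun r hr => hderiv r ⟨hr.1.le, hr.2.le.trans ht.2⟩)
  obtain ⟨σ, hσ, hσe⟩ := exists_hasDerivAt_eq_slope (fun t => F (γ t)) g
    (show t < 1 by linarith)
    (fun r hr => (hderiv r ⟨ht.1.trans hr.1, hr.2⟩).continuousAt.continuousWithinAt)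
    (fun r hr => hderiv r ⟨ht.1.trans hr.1.le, hr.2.le⟩)
  simp only [hγ0, hγ1, sub_zero] at hτe hσe
  have hτpos : 0 < g τ := by rw [hτe]; exact div_pos (sub_pos.2 hlt) ht0
  have hmain := le_exp_mul_of_local_ge (C := 5 * (L * D)) (by positivity) (by positivity) hgron
    hτ.1.le (hτ.2.le.trans hσ.1.le) hσ.2.le hτpos
  rw [show 2 * (5 * (L * D)) = 10 * (L * D) by ring] at hmain
  have hσle : g σ ≤ 2 * (F w - F v) := by
    rw [hσe, div_le_iff₀ (by linarith)]
    nlinarith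
  calc F (γ t) - F v = t * g τ := by rw [hτe]; field_simp
    _ ≤ t * (Real.exp (10 * (L * D)) * g σ) := by gcongr
    _ ≤ t * (Real.exp (10 * (L * D)) * (2 * (F w - F v))) := by gcongr
    _ = _ := by ring

/-- A quasiconvex function on a bounded convex body whose gradient is relatively Lipschitz is
quantitatively quasiconvex. -/
theorem QuasiconvexOn.sub_le_mul (hQ : QuasiconvexOn ℝ K F)
    (hF : ∀ v ∈ K, HasFDerivWithinAt F (innerSL ℝ (N v)) K v) {L D : ℝ} (hL : 0 ≤ L)
    (hN : ∀ v ∈ K, ∀ w ∈ K, ‖N v - N w‖ ≤ L * ‖v - w‖ * ‖N v‖)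
    (hD : ∀ v ∈ K, ∀ w ∈ K, ‖v - w‖ ≤ D) (hint : (interior K).Nonempty)
    {v w : E} (hv : v ∈ K) (hw : w ∈ K) {t : ℝ} (ht : t ∈ Icc (0 : ℝ) 1) :
    F ((1 - t) • v + t • w) - F v ≤
      2 * Real.exp (10 * (L * D)) * t * max (F w - F v) 0 := by
  have hconv := (quasiconvexOn_iff_le_max.1 hQ).1
  have hcont : ContinuousOn F K := fun v hv => (hF v hv).continuousWithinAt
  -- Both sides are continuous in (v, w), and pairs of interior points are dense.
  have hcl : K ⊆ closure (interior K) := by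
    rw [hconv.closure_interior_eq_closure_of_nonempty_interior hint]
    exact subset_closure
  have h1 : ContinuousOn (fun p : E × E => F p.1) (K ×ˢ K) :=
    hcont.comp continuousOn_fst fun p hp => hp.1
  have h2 : ContinuousOn (fun p : E × E => F p.2) (K ×ˢ K) :=
    hcont.comp continuousOn_snd fun p hp => hp.2
  have h3 : ContinuousOn (fun p : E × E => F ((1 - t) • p.1 + t • p.2)) (K ×ˢ K) :=
    hcont.comp (by fun_prop) fun p hp => hconv hp.1 hp.2 (by linarith [ht.2]) ht.1 (by ring)
  have hmem : (v, w) ∈ closure (interior K ×ˢ interior K) := by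
    rw [closure_prod_eq]; exact ⟨hcl hv, hcl hw⟩
  have hsub : interior K ×ˢ interior K ⊆ K ×ˢ K := prod_mono interior_subset interior_subset
  exact ContinuousWithinAt.closure_le
    (f := fun p : E × E => F ((1 - t) • p.1 + t • p.2) - F p.1)
    (g := fun p : E × E => 2 * Real.exp (10 * (L * D)) * t * max (F p.2 - F p.1) 0) hmem
    (((h3.sub h1) (v, w) ⟨hv, hw⟩).mono hsub)
    ((continuousOn_const.mul ((h2.sub h1).sup continuousOn_const) (v, w) ⟨hv, hw⟩).mono hsub)
    fun p hp => hQ.sub_le_mul_of_mem_interior hF hL hN hD hp.1 hp.2 ht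

end QuasiconvexGradient


/-! ### Inverting an injection of a compact set up to the boundary -/

section CompactInverse

open Topology

/-- The inverse of a continuous injection of a compact set is continuous on the image. -/
theorem tendsto_invFunOn_of_isCompact {α β : Type*} [TopologicalSpace α] [Nonempty α]
    [TopologicalSpace β] [T2Space β] {p : α → β} {S : Set α} (hS : IsCompact S)
    (hp : ContinuousOn p S) (hinj : InjOn p S) {s : α} (hs : s ∈ S) :
    Filter.Tendsto (Function.invFunOn p S) (𝓝[p '' S] (p s)) (𝓝[S] s) := by
  have : CompactSpace S := isCompact_iff_compactSpace.1 hS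
  have hemb := (hp.domRestrict.isClosedEmbedding (injOn_iff_injective.1 hinj)).isEmbedding
  have h1 := hemb.map_nhds_eq ⟨s, hs⟩
  rw [range_domRestrict] at h1
  change Filter.map _ _ = 𝓝[p '' S] (p s) at h1
  rw [← h1, Filter.tendsto_map'_iff, ← map_nhds_subtype_val ⟨s, hs⟩]
  have h2 : Function.invFunOn p S ∘ S.domRestrict p = Subtype.val := by
    funext z
    exact hinj.leftInvOn_invFunOn z.2
  rw [h2]
  exact Filter.tendsto_map

variable {E G : Type*} [NormedAddCommGroup E] [NormedSpace ℝ E]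
  [NormedAddCommGroup G] [NormedSpace ℝ G] {S : Set E} {p : E → E} {p' Q : E → E →L[ℝ] E}

/-- Compactness makes the inverse continuous, and a left inverse of the derivative then suffices; no
interior points are needed. -/
theorem hasFDerivWithinAt_invFunOn_of_isCompact (hS : IsCompact S) (hinj : InjOn p S)
    (hp : ∀ s ∈ S, HasFDerivWithinAt p (p' s) S s)
    (hQ : ∀ s ∈ S, (Q s).comp (p' s) = ContinuousLinearMap.id ℝ E) {s : E} (hs : s ∈ S) :
    HasFDerivWithinAt (Function.invFunOn p S) (Q s) (p '' S) (p s) := by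
  have hinv : Function.invFunOn p S (p s) = s := hinj.leftInvOn_invFunOn hs
  have h := HasFDerivWithinAt.of_comp_of_leftInverse (g := Function.invFunOn p S) (f := p)
    (f' := p' s) (f'symm := Q s) (s := p '' S) (t := S) (a := p s) (h := id)
    (by rw [hinv]; exact tendsto_invFunOn_of_isCompact hS
          (fun z hz => (hp z hz).continuousWithinAt) hinj hs)
    (by rw [hinv]; exact hp s hs) (hasFDerivWithinAt_id _ _)
    (Filter.mem_of_superset self_mem_nhdsWithin fun z hz => Function.invFunOn_eq hz)
    (fun z => by simpa using DFunLike.congr_fun (hQ s hs) z) (mem_image_of_mem p hs)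
  simpa using h

/-- If `p` maps a compact set `S` injectively onto a convex set, the increments of a function `h`
on `S` are controlled by those of `p`. -/
theorem norm_sub_le_of_convex_image (hS : IsCompact S) (hinj : InjOn p S)
    (hp : ∀ s ∈ S, HasFDerivWithinAt p (p' s) S s)
    (hQ : ∀ s ∈ S, (Q s).comp (p' s) = ContinuousLinearMap.id ℝ E) (hconv : Convex ℝ (p '' S))
    {h : E → G} {h' : E → E →L[ℝ] G} (hh : ∀ s ∈ S, HasFDerivWithinAt h (h' s) S s) {B : ℝ}
    (hB : ∀ s ∈ S, ‖(h' s).comp (Q s)‖ ≤ B) {a b : E} (ha : a ∈ S) (hb : b ∈ S) :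
    ‖h a - h b‖ ≤ B * ‖p a - p b‖ := by
  have hinv : ∀ s ∈ S, Function.invFunOn p S (p s) = s := fun s hs => hinj.leftInvOn_invFunOn hs
  have hmem : ∀ q ∈ p '' S, Function.invFunOn p S q ∈ S := fun q hq => Function.invFunOn_mem hq
  -- The mean value inequality is applied to h ∘ p⁻¹ on the convex image, since S itself need not be
  -- convex.
  have hder : ∀ q ∈ p '' S, HasFDerivWithinAt (h ∘ Function.invFunOn p S)
      ((h' (Function.invFunOn p S q)).comp (Q (Function.invFunOn p S q))) (p '' S) q := by
    rintro _ ⟨s, hs, rfl⟩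
    rw [hinv s hs]
    refine HasFDerivWithinAt.comp (t := S) _ ?_
      (hasFDerivWithinAt_invFunOn_of_isCompact hS hinj hp hQ hs) hmem
    rw [hinv s hs]
    exact hh s hs
  have := Convex.norm_image_sub_le_of_norm_hasFDerivWithin_le hder
    (fun q hq => hB _ (hmem q hq)) hconv (mem_image_of_mem p hb) (mem_image_of_mem p ha)
  simpa [hinv a ha, hinv b hb] using this

end CompactInverse

/-! ### Estimates for the cost -/

section Cost

variable {n : ℕ} {X Y : Set (Rn n)} {c : Rn n → Rn n → ℝ} {Dx Dy : Rn n → Rn n → Rn n}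
  {Dxy Dyx : Rn n → Rn n → Rn n →L[ℝ] Rn n}

open Topology in
-- At an interior point of Y, continuity of the Hessian makes the derivative strict, and its
-- surjectivity makes the map open there.
theorem HasMixedHessians.interior_YStar_nonempty (hc : HasMixedHessians X Y c Dx Dy Dxy Dyx)
    (hYint : (interior Y).Nonempty) {x : Rn n} (hx : x ∈ X)
    (hunit : ∀ y ∈ Y, IsUnit (Dxy x y)) (hcont : ContinuousOn (fun y => Dxy x y) Y) :
    (interior (YStar Y Dx x)).Nonempty := by
  obtain ⟨y, hy⟩ := hYint
  have hnhds : ∀ z ∈ interior Y, Y ∈ 𝓝 z := fun z hz => mem_interior_iff_mem_nhds.1 hz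
  have hstrict : HasStrictFDerivAt (fun y => -Dx x y) (-Dxy x y) y := by
    refine HasStrictFDerivAt.neg (hasStrictFDerivAt_of_hasFDerivAt_of_continuousAt
      (f' := fun y => Dxy x y) ?_
      ((hcont y (interior_subset hy)).continuousAt (hnhds y hy)))
    filter_upwards [isOpen_interior.mem_nhds hy] with z hz
    exact (hc.hess_xy x hx z (interior_subset hz)).hasFDerivAt (hnhds z hz)
  have hsurj : (-Dxy x y).range = ⊤ := by
    obtain ⟨I, hI⟩ := (hunit y (interior_subset hy)).exists_right_inv
    rw [LinearMap.range_eq_top]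
    intro z
    refine ⟨-I z, ?_⟩
    simpa using DFunLike.congr_fun hI z
  have hmap := hstrict.map_nhds_eq_of_surj hsurj
  refine ⟨-Dx x y, mem_interior_iff_mem_nhds.2 ?_⟩
  rw [← hmap]
  exact Filter.image_mem_map (hnhds y hy)

/-- Inversion is continuous on units and X × Y is compact. -/
theorem exists_norm_le_of_isUnit (hX : IsCompact X) (hY : IsCompact Y)
    (hunit : ∀ x ∈ X, ∀ y ∈ Y, IsUnit (Dxy x y))
    (hcont : ContinuousOn (fun p : Rn n × Rn n => Dxy p.1 p.2) (X ×ˢ Y)) :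
    ∃ C : ℝ, 0 ≤ C ∧ ∀ x ∈ X, ∀ y ∈ Y, ‖Dxy x y‖ ≤ C ∧ ‖Ring.inverse (Dxy x y)‖ ≤ C := by
  have hinv : ContinuousOn (fun p : Rn n × Rn n => Ring.inverse (Dxy p.1 p.2)) (X ×ˢ Y) := by
    intro p hp
    obtain ⟨u, hu⟩ := hunit p.1 hp.1 p.2 hp.2
    have h := NormedRing.inverse_continuousAt u
    rw [hu] at h
    exact h.comp_continuousWithinAt (f := fun p : Rn n × Rn n => Dxy p.1 p.2) (hcont p hp)
  obtain ⟨C₁, h₁⟩ := (hX.prod hY).exists_bound_of_continuousOn hcont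
  obtain ⟨C₂, h₂⟩ := (hX.prod hY).exists_bound_of_continuousOn hinv
  exact ⟨max 0 (max C₁ C₂), le_max_left _ _, fun x hx y hy =>
    ⟨(h₁ (x, y) ⟨hx, hy⟩).trans ((le_max_left _ _).trans (le_max_right _ _)),
      (h₂ (x, y) ⟨hx, hy⟩).trans ((le_max_right _ _).trans (le_max_right _ _))⟩⟩

theorem norm_inverse_sub_inverse_le {A B : Rn n →L[ℝ] Rn n} (hA : IsUnit A) (hB : IsUnit B) :
    ‖Ring.inverse A - Ring.inverse B‖ ≤ ‖Ring.inverse A‖ * ‖A - B‖ * ‖Ring.inverse B‖ := by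
  have h : Ring.inverse A - Ring.inverse B = Ring.inverse A * (B - A) * Ring.inverse B := by
    rw [mul_sub, sub_mul, mul_assoc, Ring.mul_inverse_cancel _ hB, mul_one,
      Ring.inverse_mul_cancel _ hA, one_mul]
  rw [h, norm_sub_rev A B]
  exact (norm_mul_le _ _).trans (mul_le_mul_of_nonneg_right (norm_mul_le _ _) (norm_nonneg _))

/-- The gradient of `v ↦ -c(x, exp_{x₀} v) + c(x₀, exp_{x₀} v)`. -/
noncomputable def gradSeg (Y : Set (Rn n)) (Dx Dy : Rn n → Rn n → Rn n)
    (Dxy : Rn n → Rn n → Rn n →L[ℝ] Rn n) (x₀ x v : Rn n) : Rn n :=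
  ContinuousLinearMap.adjoint (Ring.inverse (Dxy x₀ (cExp Y Dx x₀ v)))
    (Dy x (cExp Y Dx x₀ v) - Dy x₀ (cExp Y Dx x₀ v))

theorem neg_inverse_comp_neg {A : Rn n →L[ℝ] Rn n} (hA : IsUnit A) :
    (-Ring.inverse A).comp (-A) = ContinuousLinearMap.id ℝ (Rn n) := by
  have h := Ring.inverse_mul_cancel _ hA
  ext1 z
  simpa using DFunLike.congr_fun h z

theorem adjoint_inverse_comp_adjoint {A : Rn n →L[ℝ] Rn n} (hA : IsUnit A) :
    (ContinuousLinearMap.adjoint (Ring.inverse A)).comp (ContinuousLinearMap.adjoint A) =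
      ContinuousLinearMap.id ℝ (Rn n) := by
  rw [← ContinuousLinearMap.adjoint_comp]
  have h : A.comp (Ring.inverse A) = ContinuousLinearMap.id ℝ (Rn n) := Ring.mul_inverse_cancel _ hA
  rw [h, ContinuousLinearMap.adjoint_id]

theorem adjoint_comp_adjoint_inverse {A : Rn n →L[ℝ] Rn n} (hA : IsUnit A) :
    (ContinuousLinearMap.adjoint A).comp (ContinuousLinearMap.adjoint (Ring.inverse A)) =
      ContinuousLinearMap.id ℝ (Rn n) := by
  rw [← ContinuousLinearMap.adjoint_comp]
  have h : (Ring.inverse A).comp A = ContinuousLinearMap.id ℝ (Rn n) := Ring.inverse_mul_cancel _ hA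
  rw [h, ContinuousLinearMap.adjoint_id]

theorem HasMixedHessians.hasFDerivWithinAt_cExp (hc : HasMixedHessians X Y c Dx Dy Dxy Dyx)
    (hY : IsCompact Y) {x₀ : Rn n} (hx₀ : x₀ ∈ X) (hinj : InjOn (fun y => -Dx x₀ y) Y)
    (hunit : ∀ y ∈ Y, IsUnit (Dxy x₀ y)) {v : Rn n} (hv : v ∈ YStar Y Dx x₀) :
    HasFDerivWithinAt (cExp Y Dx x₀) (-Ring.inverse (Dxy x₀ (cExp Y Dx x₀ v)))
      (YStar Y Dx x₀) v := by
  have h := hasFDerivWithinAt_invFunOn_of_isCompact (p' := fun y => -Dxy x₀ y)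
    (Q := fun y => -Ring.inverse (Dxy x₀ y)) hY hinj
    (fun y hy => (hc.hess_xy x₀ hx₀ y hy).neg)
    (fun y hy => neg_inverse_comp_neg (hunit y hy)) (cExp_mem hv)
  rw [neg_Dx_cExp hv] at h
  exact h

theorem HasMixedHessians.hasFDerivWithinAt_gradSeg (hc : HasMixedHessians X Y c Dx Dy Dxy Dyx)
    (hY : IsCompact Y) {x₀ x : Rn n} (hx₀ : x₀ ∈ X) (hx : x ∈ X)
    (hinj : InjOn (fun y => -Dx x₀ y) Y) (hunit : ∀ y ∈ Y, IsUnit (Dxy x₀ y))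
    {v : Rn n} (hv : v ∈ YStar Y Dx x₀) :
    HasFDerivWithinAt (fun v => -c x (cExp Y Dx x₀ v) + c x₀ (cExp Y Dx x₀ v))
      (innerSL ℝ (gradSeg Y Dx Dy Dxy x₀ x v)) (YStar Y Dx x₀) v := by
  have he := hc.hasFDerivWithinAt_cExp hY hx₀ hinj hunit hv
  have hmaps : MapsTo (cExp Y Dx x₀) (YStar Y Dx x₀) Y := fun w hw => cExp_mem hw
  have h1 := (hc.grad_y x hx _ (cExp_mem hv)).hasFDerivWithinAt.comp v he hmaps
  have h2 := (hc.grad_y x₀ hx₀ _ (cExp_mem hv)).hasFDerivWithinAt.comp v he hmaps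
  -- The minus sign in the derivative of `cExp` cancels the one in front of c(x, ·).
  refine (h1.neg.add h2).congr_fderiv ?_
  ext1 ξ
  simp only [gradSeg, innerSL_apply_apply, ContinuousLinearMap.adjoint_inner_left, inner_sub_left]
  simp
  ring

/-- The gradient of `v ↦ -c(x, exp_{x₀} v) + c(x₀, exp_{x₀} v)` is Lipschitz relative to its own
size. -/
theorem HasMixedHessians.norm_gradSeg_sub_le (hc : HasMixedHessians X Y c Dx Dy Dxy Dyx)
    (hX : IsCompact X) (hY : IsCompact Y)
    (hTranspose : ∀ x ∈ X, ∀ y ∈ Y, ContinuousLinearMap.adjoint (Dxy x y) = Dyx x y)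
    (hTwisted : ∀ x ∈ X, InjOn (fun y => -Dx x y) Y)
    (hTwistedStar : ∀ y ∈ Y, InjOn (fun x => -Dy x y) X)
    (hunit : ∀ x ∈ X, ∀ y ∈ Y, IsUnit (Dxy x y))
    {Λ : ℝ≥0} (hLip : LipschitzOnWith Λ (fun p : Rn n × Rn n => Dxy p.1 p.2) (X ×ˢ Y))
    (hDomConv : ∀ x ∈ X, Convex ℝ (YStar Y Dx x))
    (hDomConvStar : ∀ y ∈ Y, Convex ℝ (XStar X Dy y)) {C : ℝ} (hC : 0 ≤ C)
    (hbound : ∀ x ∈ X, ∀ y ∈ Y, ‖Dxy x y‖ ≤ C ∧ ‖Ring.inverse (Dxy x y)‖ ≤ C)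
    {x₀ x : Rn n} (hx₀ : x₀ ∈ X) (hx : x ∈ X) {v w : Rn n} (hv : v ∈ YStar Y Dx x₀)
    (hw : w ∈ YStar Y Dx x₀) :
    ‖gradSeg Y Dx Dy Dxy x₀ x v - gradSeg Y Dx Dy Dxy x₀ x w‖ ≤
      2 * C ^ 4 * Λ * ‖v - w‖ * ‖gradSeg Y Dx Dy Dxy x₀ x v‖ := by
  have hy := cExp_mem hv
  have hy' := cExp_mem hw
  have hexp : ‖cExp Y Dx x₀ v - cExp Y Dx x₀ w‖ ≤ C * ‖v - w‖ := by
    have h := norm_sub_le_of_convex_image (p' := fun y => -Dxy x₀ y)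
      (Q := fun y => -Ring.inverse (Dxy x₀ y)) hY (hTwisted x₀ hx₀)
      (fun y hy => (hc.hess_xy x₀ hx₀ y hy).neg)
      (fun y hy => neg_inverse_comp_neg (hunit x₀ hx₀ y hy)) (hDomConv x₀ hx₀)
      (h := id) (h' := fun _ => ContinuousLinearMap.id ℝ _) (fun y _ => hasFDerivWithinAt_id y Y)
      (B := C) (fun y hy => by simpa using (hbound x₀ hx₀ y hy).2) hy hy'
    simpa only [id, neg_Dx_cExp hv, neg_Dx_cExp hw] using h
  unfold gradSeg
  generalize cExp Y Dx x₀ v = y at *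
  generalize cExp Y Dx x₀ w = y' at *
  have hLy : ∀ z ∈ X, ‖Dxy z y - Dxy z y'‖ ≤ Λ * ‖y - y'‖ := by
    intro z hz
    have h := hLip.dist_le_mul (z, y) ⟨hz, hy⟩ (z, y') ⟨hz, hy'⟩
    simpa [Prod.dist_eq, dist_eq_norm] using h
  set g := Dy x y - Dy x₀ y with hg
  set g' := Dy x y' - Dy x₀ y' with hg'
  -- The key use of convexity of X*_y: in the coordinate -D_y c(·, y), the points x and x₀ are
  -- joined by a segment of length |g|, so the bound is proportional to |g|.
  have hgg : ‖g - g'‖ ≤ Λ * ‖y - y'‖ * C * ‖g‖ := by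
    have h := norm_sub_le_of_convex_image (p := fun x => -Dy x y) (p' := fun x => -Dyx x y)
      (Q := fun x => -ContinuousLinearMap.adjoint (Ring.inverse (Dxy x y))) hX (hTwistedStar y hy)
      (fun z hz => (hc.hess_yx z hz y hy).neg)
      (fun z hz => by
        rw [← hTranspose z hz y hy, ContinuousLinearMap.neg_comp, ContinuousLinearMap.comp_neg,
          neg_neg, adjoint_inverse_comp_adjoint (hunit z hz y hy)])
      (hDomConvStar y hy) (h := fun x => Dy x y - Dy x y') (h' := fun x => Dyx x y - Dyx x y')
      (fun z hz => (hc.hess_yx z hz y hy).sub (hc.hess_yx z hz y' hy'))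
      (B := Λ * ‖y - y'‖ * C) (fun z hz => by
        refine (ContinuousLinearMap.opNorm_comp_le _ _).trans ?_
        rw [← hTranspose z hz y hy, ← hTranspose z hz y' hy', ← map_sub, norm_neg,
          LinearIsometryEquiv.norm_map, LinearIsometryEquiv.norm_map]
        exact mul_le_mul (hLy z hz) (hbound z hz y hy).2 (norm_nonneg _) (by positivity))
      hx hx₀
    have e1 : g - g' = Dy x y - Dy x y' - (Dy x₀ y - Dy x₀ y') := by rw [hg, hg']; abel
    have e2 : ‖-Dy x y - -Dy x₀ y‖ = ‖g‖ := by rw [hg, ← norm_neg]; congr 1; abel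
    rw [e1, ← e2]
    exact h
  set J := ContinuousLinearMap.adjoint (Ring.inverse (Dxy x₀ y)) with hJ
  set J' := ContinuousLinearMap.adjoint (Ring.inverse (Dxy x₀ y')) with hJ'
  have hJJ : ‖J - J'‖ ≤ C * (Λ * ‖y - y'‖) * C := by
    rw [hJ, hJ', ← map_sub, LinearIsometryEquiv.norm_map]
    refine (norm_inverse_sub_inverse_le (hunit x₀ hx₀ y hy) (hunit x₀ hx₀ y' hy')).trans ?_
    have := hLy x₀ hx₀
    have := (hbound x₀ hx₀ y hy).2
    have := (hbound x₀ hx₀ y' hy').2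
    gcongr
  have hJ'C : ‖J'‖ ≤ C := by
    rw [hJ', LinearIsometryEquiv.norm_map]
    exact (hbound x₀ hx₀ y' hy').2
  -- Undoing J bounds |g| by the gradient itself, which makes the estimate relative.
  have hgJ : ‖g‖ ≤ C * ‖J g‖ := by
    have h : ContinuousLinearMap.adjoint (Dxy x₀ y) (J g) = g :=
      DFunLike.congr_fun (adjoint_comp_adjoint_inverse (hunit x₀ hx₀ y hy)) g
    have h' := ContinuousLinearMap.le_opNorm (ContinuousLinearMap.adjoint (Dxy x₀ y)) (J g)
    rw [h] at h'
    rw [LinearIsometryEquiv.norm_map] at h'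
    exact h'.trans (mul_le_mul_of_nonneg_right (hbound x₀ hx₀ y hy).1 (norm_nonneg _))
  have hsplit : J g - J' g' = (J - J') g + J' (g - g') := by simp
  calc ‖J g - J' g'‖ ≤ ‖J - J'‖ * ‖g‖ + ‖J'‖ * ‖g - g'‖ := by
        rw [hsplit]
        exact (norm_add_le _ _).trans
          (add_le_add (ContinuousLinearMap.le_opNorm _ _) (ContinuousLinearMap.le_opNorm _ _))
    _ ≤ C * (Λ * ‖y - y'‖) * C * ‖g‖ + C * (Λ * ‖y - y'‖ * C * ‖g‖) := by gcongr
    _ = 2 * C ^ 2 * Λ * ‖y - y'‖ * ‖g‖ := by ring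
    _ ≤ 2 * C ^ 2 * Λ * (C * ‖v - w‖) * (C * ‖J g‖) := by gcongr
    _ = _ := by ring

/-- The sets `Y*_x` are bounded, uniformly in `x`. -/
theorem HasMixedHessians.exists_norm_sub_le (hc : HasMixedHessians X Y c Dx Dy Dxy Dyx)
    (hY : IsCompact Y) (hTwisted : ∀ x ∈ X, InjOn (fun y => -Dx x y) Y)
    (hunit : ∀ x ∈ X, ∀ y ∈ Y, IsUnit (Dxy x y)) (hDomConv : ∀ x ∈ X, Convex ℝ (YStar Y Dx x))
    {C : ℝ} (hC : 0 ≤ C)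
    (hbound : ∀ x ∈ X, ∀ y ∈ Y, ‖Dxy x y‖ ≤ C ∧ ‖Ring.inverse (Dxy x y)‖ ≤ C) :
    ∃ D : ℝ, ∀ x ∈ X, ∀ v ∈ YStar Y Dx x, ∀ w ∈ YStar Y Dx x, ‖v - w‖ ≤ D := by
  rcases X.eq_empty_or_nonempty with rfl | ⟨x₁, hx₁⟩
  · exact ⟨0, fun x hx => absurd hx (notMem_empty x)⟩
  obtain ⟨R, hR⟩ := hY.exists_bound_of_continuousOn
    (f := fun y => -Dx x₁ y) fun y hy => (hc.hess_xy x₁ hx₁ y hy).neg.continuousWithinAt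
  -- All Y*_x are compared with the one at x₁ through maps with derivative at most C²; no continuity
  -- of D_x c in x is needed.
  refine ⟨C * C * (R + R), ?_⟩
  rintro x hx _ ⟨y, hy, rfl⟩ _ ⟨y', hy', rfl⟩
  have h := norm_sub_le_of_convex_image (p' := fun y => -Dxy x₁ y)
    (Q := fun y => -Ring.inverse (Dxy x₁ y)) hY (hTwisted x₁ hx₁)
    (fun y hy => (hc.hess_xy x₁ hx₁ y hy).neg)
    (fun y hy => neg_inverse_comp_neg (hunit x₁ hx₁ y hy)) (hDomConv x₁ hx₁)
    (h := fun y => -Dx x y) (h' := fun y => -Dxy x y) (fun y hy => (hc.hess_xy x hx y hy).neg)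
    (B := C * C) (fun y hy => by
      refine (ContinuousLinearMap.opNorm_comp_le (-Dxy x y) (-Ring.inverse (Dxy x₁ y))).trans ?_
      rw [norm_neg, norm_neg]
      exact mul_le_mul (hbound x hx y hy).1 (hbound x₁ hx₁ y hy).2 (norm_nonneg _) hC) hy hy'
  refine h.trans (mul_le_mul_of_nonneg_left ?_ (by positivity))
  exact (norm_sub_le _ _).trans (add_le_add (hR y hy) (hR y' hy'))

end Cost

theorem theorem1p1 (n : ℕ) (X Y : Set (Rn n)) (hX : IsCompact X) (hY : IsCompact Y)
    (hYint : (interior Y).Nonempty)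
    (c : Rn n → Rn n → ℝ) (Dx Dy : Rn n → Rn n → Rn n)
    (Dxy Dyx : Rn n → Rn n → Rn n →L[ℝ] Rn n)
    (hc : HasMixedHessians X Y c Dx Dy Dxy Dyx)
    (hTranspose : ∀ x ∈ X, ∀ y ∈ Y, ContinuousLinearMap.adjoint (Dxy x y) = Dyx x y)
    (hTwisted : ∀ x ∈ X, InjOn (fun y => -Dx x y) Y)
    (hTwistedStar : ∀ y ∈ Y, InjOn (fun x => -Dy x y) X)
    (hNonDegenerate : ∀ x ∈ X, ∀ y ∈ Y, IsUnit (Dxy x y))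
    (hLipHessian : ∃ Λ : ℝ≥0, LipschitzOnWith Λ (fun p : Rn n × Rn n => Dxy p.1 p.2) (X ×ˢ Y))
    (hDomConv : ∀ x ∈ X, Convex ℝ (YStar Y Dx x))
    (hDomConvStar : ∀ y ∈ Y, Convex ℝ (XStar X Dy y))
    (hLoeper : LoeperCondition X Y c Dx) :
    QQconv X Y c Dx := by
  obtain ⟨Λ, hLip⟩ := hLipHessian
  obtain ⟨C, hC, hbound⟩ := exists_norm_le_of_isUnit hX hY hNonDegenerate hLip.continuousOn
  obtain ⟨D, hD⟩ := hc.exists_norm_sub_le hY hTwisted hNonDegenerate hDomConv hC hbound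
  -- `max 1` gives M ≥ 1 whatever the sign of D, which `hD` does not control when X is empty.
  refine ⟨max 1 (2 * Real.exp (10 * (2 * C ^ 4 * Λ * D))), le_max_left _ _, ?_⟩
  intro x hx x₀ hx₀ v₀ hv₀ v₁ hv₁ t ht
  set F : Rn n → ℝ := fun v => -c x (cExp Y Dx x₀ v) + c x₀ (cExp Y Dx x₀ v) with hF
  have hseg : ∀ v w t, fSeg Y c Dx x₀ v w t x = F ((1 - t) • v + t • w) := fun _ _ _ => rfl
  have hseg0 : ∀ v w, fSeg Y c Dx x₀ v w 0 x = F v := fun v w => by simp [hseg]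
  have hseg1 : ∀ v w, fSeg Y c Dx x₀ v w 1 x = F w := fun v w => by simp [hseg]
  have hQ : QuasiconvexOn ℝ (YStar Y Dx x₀) F := by
    refine quasiconvexOn_iff_le_max.2 ⟨hDomConv x₀ hx₀, ?_⟩
    intro v hv w hw a b ha hb hab
    have h := hLoeper x hx x₀ hx₀ v hv w hw b ⟨hb, by linarith⟩
    rwa [hseg, hseg0, hseg1, max_comm, ← hab, add_sub_cancel_right] at h
  have hint := hc.interior_YStar_nonempty hYint hx₀ (hNonDegenerate x₀ hx₀)
    (hLip.continuousOn.comp (f := fun y => (x₀, y)) (by fun_prop) fun y hy => ⟨hx₀, hy⟩)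
  have hmain := hQ.sub_le_mul
    (fun v hv => hc.hasFDerivWithinAt_gradSeg hY hx₀ hx (hTwisted x₀ hx₀)
      (hNonDegenerate x₀ hx₀) hv)
    (L := 2 * C ^ 4 * Λ) (by positivity)
    (fun v hv w hw => hc.norm_gradSeg_sub_le hX hY hTranspose hTwisted hTwistedStar
      hNonDegenerate hLip hDomConv hDomConvStar hC hbound hx₀ hx hv hw)
    (hD x₀ hx₀) hint hv₀ hv₁ ht
  rw [hseg, hseg0, hseg1]
  refine hmain.trans ?_
  have := ht.1
  gcongr
  exact le_max_right _ _
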